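/- Let $\nu\in\mathbb{R}$ and $\tau_0>0$, and let $x$ be either of the Bessel functions $J_\nu$, $Y_\nu$ (of the first and second kind, of order $\nu$), considered on $[\tau_0,\infty)$. Then the phase dimension of $x$ equals $4/3$; that is, $x$ is of class $C^1$, the planar curve $\Gamma=\{(x(t),\dot x(t)) : t\in[\tau_0,\infty)\}\subset\mathbb{R}^2$ is bounded, and its box dimension exists and $\dim_B\Gamma=\frac43$. Here, for a bounded set $A\subset\mathbb{R}^N$ with open $\varepsilon$-neighbourhood $A_\varepsilon$ and Lebesgue measure $|A_\varepsilon|$, the lower and upper box dimensions are $\inf\{s\ge 0 : \liminf_{\varepsilon\to0^+}|A_\varepsilon|/\varepsilon^{N-s}=0\}$ and $\inf\{s\ge 0 : \limsup_{\varepsilon\to0^+}|A_\varepsilon|/\varepsilon^{N-s}=0\}$; if they coincide, the common value is the box dimension $\dim_B A$. -/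

import Mathlib

open Set Filter Topology MeasureTheory
open scoped ENNReal Nat

noncomputable section

/-- Lower `s`-dimensional Minkowski content of `A ⊆ ℝᴺ`: the lower limit, as `ε → 0⁺`, of
`|A_ε| / ε ^ (N - s)`, where `A_ε` is the open `ε`-neighbourhood of `A` and `|·|` is Lebesgue
measure. -/
def lowerMinkowskiContent {N : ℕ} (s : ℝ) (A : Set (EuclideanSpace ℝ (Fin N))) : ℝ≥0∞ :=
  liminf (fun ε : ℝ => volume (Metric.thickening ε A) / ENNReal.ofReal (ε ^ ((N : ℝ) - s)))
    (𝓝[>] (0 : ℝ))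

/-- Upper `s`-dimensional Minkowski content of `A ⊆ ℝᴺ`. -/
def upperMinkowskiContent {N : ℕ} (s : ℝ) (A : Set (EuclideanSpace ℝ (Fin N))) : ℝ≥0∞ :=
  limsup (fun ε : ℝ => volume (Metric.thickening ε A) / ENNReal.ofReal (ε ^ ((N : ℝ) - s)))
    (𝓝[>] (0 : ℝ))

/-- Lower box dimension of a bounded set `A ⊆ ℝᴺ`. -/
def lowerBoxDim {N : ℕ} (A : Set (EuclideanSpace ℝ (Fin N))) : ℝ :=
  sInf {s : ℝ | 0 ≤ s ∧ lowerMinkowskiContent s A = 0}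

/-- Upper box dimension of a bounded set `A ⊆ ℝᴺ`. -/
def upperBoxDim {N : ℕ} (A : Set (EuclideanSpace ℝ (Fin N))) : ℝ :=
  sInf {s : ℝ | 0 ≤ s ∧ upperMinkowskiContent s A = 0}

/-- `A` is bounded and its box dimension exists (the lower and the upper box dimension coincide)
and equals `d`. -/
def HasBoxDim {N : ℕ} (A : Set (EuclideanSpace ℝ (Fin N))) (d : ℝ) : Prop :=
  Bornology.IsBounded A ∧ lowerBoxDim A = d ∧ upperBoxDim A = d

/-- The planar curve `{(x(t), x'(t)) : t ∈ [t₀, ∞)}` of a function `x : [t₀, ∞) → ℝ`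
(the derivative at `t₀` is the one-sided one). -/
def phaseCurve (x : ℝ → ℝ) (t₀ : ℝ) : Set (EuclideanSpace ℝ (Fin 2)) :=
  (fun t : ℝ => !₂[x t, derivWithin x (Ici t₀) t]) '' Ici t₀

/-- `x` is of class `C¹` on `[t₀, ∞)` and its phase dimension, the box dimension of its phase
curve, exists and equals `d`. -/
def HasPhaseDim (x : ℝ → ℝ) (t₀ d : ℝ) : Prop :=
  ContDiffOn ℝ 1 x (Ici t₀) ∧ HasBoxDim (phaseCurve x t₀) d

/-- Bessel function of the first kind of real order `ν`, for `t > 0`: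
`J_ν(t) = ∑ₖ (-1)ᵏ / (k! Γ(ν + k + 1)) (t / 2) ^ (2k + ν)`.
Here `1 / Γ` is `0` at the poles of `Γ`, in accordance with `Real.Gamma (-n) = 0` for `n : ℕ`
and division by zero being zero. -/
def besselJ (ν t : ℝ) : ℝ :=
  (t / 2) ^ ν * ∑' k : ℕ, (-1) ^ k / ((k ! : ℝ) * Real.Gamma (ν + k + 1)) * (t / 2) ^ (2 * k)

/-- The expression that defines the Bessel function of the second kind at non-integer order. -/
def besselYAux (ν t : ℝ) : ℝ :=
  (besselJ ν t * Real.cos (ν * Real.pi) - besselJ (-ν) t) / Real.sin (ν * Real.pi)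

open Classical in
/-- Bessel function of the second kind of real order `ν`, for `t > 0`:
`Y_ν(t) = (J_ν(t) cos(νπ) - J_{-ν}(t)) / sin(νπ)` if `ν` is not an integer, and
`Y_n(t) = lim_{s → n} Y_s(t)`, `s ≠ n`, at an integer `n`. -/
def besselY (ν t : ℝ) : ℝ :=
  if ∃ n : ℤ, ν = n then limUnder (𝓝[≠] ν) (fun s : ℝ => besselYAux s t)
  else besselYAux ν t

end

/-!
Both functions solve Bessel's equation `t² x'' + t x' + (t² - ν²) x = 0`, and the phase dimension
of every nontrivial solution is `4 / 3`.

For the second claim, `u = √t x` satisfies `u'' + (1 - (ν² - 1 / 4) / t²) u = 0`, so that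
`ζ = (u + i u') exp (i t)` satisfies `‖ζ'‖ = O(‖ζ‖ / t²)`. Hence `ζ` has a limit `Z ≠ 0`, and
`x + i x' = t ^ (-1 / 2) Z exp (-i t) + O(t ^ (-3 / 2))`
(`IsBesselSolution.exists_asymptotics`): the phase curve is close to the spiral
`r = c φ ^ (-1 / 2)`. Its `ε`-neighbourhood has area comparable to `ε ^ (2 / 3) = ε ^ (2 - 4 / 3)`,
from which the dimension can be read off (`hasBoxDim_of_volume_thickening_bounds`). In the parameter `s = √t` the
curve is Lipschitz and of norm `O(1 / s)`, which gives the upper bound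
(`exists_volume_thickening_le`). Consecutive turns at distance `r` from the origin are `O(r ^ 3)`
apart, so the `ε`-neighbourhood contains a punctured disk of radius comparable to `ε ^ (1 / 3)`,
which gives the lower bound (`exists_le_volume_thickening`).

For the first claim, the power series yields the recurrences
`J_ν' = (ν / t) J_ν - J_{ν + 1}` and `J_{ν - 1} = (2 ν / t) J_ν - J_{ν + 1}`, which imply Bessel's
equation. Away from the integers they carry over to `Y_ν` by algebra. At an integer, `J_s(t)` is
differentiable in the order `s`, so the defining limit of `Y_s` exists (`tendsto_besselYAux`), and a
bound on second derivatives that is uniform in `s` lets the derivative pass to the limit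
(`hasDerivAt_of_tendsto_isBesselSolution`). Neither function is trivial, because
`J_ν Y_{ν - 1} - J_{ν - 1} Y_ν = 2 / (π t)` (`besselJ_besselY_wronskian`).
-/

/-! ### Box dimension from two-sided bounds on the area of neighbourhoods -/

section BoxDim

variable {N : ℕ} {A : Set (EuclideanSpace ℝ (Fin N))} {c C d s : ℝ}

lemma upperMinkowskiContent_eq_zero_of_volume_le
    (hub : ∀ᶠ ε : ℝ in 𝓝[>] 0,
      volume (Metric.thickening ε A) ≤ ENNReal.ofReal (C * ε ^ ((N : ℝ) - d)))
    (hs : d < s) : upperMinkowskiContent s A = 0 := by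
  have hlim : Tendsto (fun ε : ℝ => ENNReal.ofReal (C * ε ^ (s - d))) (𝓝[>] 0) (𝓝 0) := by
    rw [← ENNReal.ofReal_zero]
    apply ENNReal.tendsto_ofReal
    have h1 : ContinuousAt (fun ε : ℝ => ε ^ (s - d)) 0 :=
      Real.continuousAt_rpow_const 0 (s - d) (Or.inr (sub_pos.2 hs).le)
    have h2 := (h1.tendsto.const_mul C).mono_left (nhdsWithin_le_nhds (s := Ioi (0 : ℝ)))
    simpa [Real.zero_rpow (sub_pos.2 hs).ne'] using h2
  refine (tendsto_of_tendsto_of_tendsto_of_le_of_le' tendsto_const_nhds hlim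
    (Eventually.of_forall fun _ => zero_le) ?_).limsup_eq
  filter_upwards [hub, self_mem_nhdsWithin] with ε h (hε : 0 < ε)
  have hp : 0 < ε ^ ((N : ℝ) - s) := Real.rpow_pos_of_pos hε _
  refine ENNReal.div_le_of_le_mul (h.trans_eq ?_)
  rw [← ENNReal.ofReal_mul' hp.le, mul_assoc, ← Real.rpow_add hε]
  ring_nf

lemma lowerMinkowskiContent_ne_zero_of_le_volume (hc : 0 < c)
    (hlb : ∀ᶠ ε : ℝ in 𝓝[>] 0,
      ENNReal.ofReal (c * ε ^ ((N : ℝ) - d)) ≤ volume (Metric.thickening ε A))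
    (hs : s ≤ d) : lowerMinkowskiContent s A ≠ 0 := by
  have : ENNReal.ofReal c ≤ lowerMinkowskiContent s A := by
    refine le_liminf_of_le (by isBoundedDefault) ?_
    have h1 : ∀ᶠ ε : ℝ in 𝓝[>] 0, ε ≤ 1 :=
      nhdsWithin_le_nhds (Iic_mem_nhds (by norm_num))
    filter_upwards [hlb, self_mem_nhdsWithin, h1] with ε h (hε : 0 < ε) hε1
    have hp : 0 < ε ^ ((N : ℝ) - s) := Real.rpow_pos_of_pos hε _
    rw [ENNReal.le_div_iff_mul_le (Or.inl (by simpa using hp)) (Or.inl ENNReal.ofReal_ne_top)]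
    refine le_trans ?_ h
    rw [← ENNReal.ofReal_mul' hp.le]
    refine ENNReal.ofReal_le_ofReal (mul_le_mul_of_nonneg_left ?_ hc.le)
    exact Real.rpow_le_rpow_of_exponent_ge hε hε1 (by linarith)
  exact ((ENNReal.ofReal_pos.2 hc).trans_le this).ne'

lemma hasBoxDim_of_volume_thickening_bounds (hA : Bornology.IsBounded A) (hd : 0 ≤ d) (hc : 0 < c)
    (hlb : ∀ᶠ ε : ℝ in 𝓝[>] 0,
      ENNReal.ofReal (c * ε ^ ((N : ℝ) - d)) ≤ volume (Metric.thickening ε A))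
    (hub : ∀ᶠ ε : ℝ in 𝓝[>] 0,
      volume (Metric.thickening ε A) ≤ ENNReal.ofReal (C * ε ^ ((N : ℝ) - d))) :
    HasBoxDim A d := by
  have hle : ∀ s, lowerMinkowskiContent s A ≤ upperMinkowskiContent s A := fun s =>
    liminf_le_limsup
  have hU : {s : ℝ | 0 ≤ s ∧ upperMinkowskiContent s A = 0} = Ioi d := by
    ext s
    refine ⟨fun h => mem_Ioi.2 (not_le.1 fun hsd => ?_), fun h => ⟨hd.trans (le_of_lt h),
      upperMinkowskiContent_eq_zero_of_volume_le hub h⟩⟩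
    exact lowerMinkowskiContent_ne_zero_of_le_volume hc hlb hsd
      (le_antisymm ((hle s).trans_eq h.2) zero_le)
  have hL : {s : ℝ | 0 ≤ s ∧ lowerMinkowskiContent s A = 0} = Ioi d := by
    ext s
    refine ⟨fun h => mem_Ioi.2 (not_le.1 fun hsd =>
      lowerMinkowskiContent_ne_zero_of_le_volume hc hlb hsd h.2),
      fun h => ⟨hd.trans (le_of_lt h), ?_⟩⟩
    exact le_antisymm ((hle s).trans_eq (upperMinkowskiContent_eq_zero_of_volume_le hub h)) zero_le
  exact ⟨hA, by rw [lowerBoxDim, hL, csInf_Ioi], by rw [upperBoxDim, hU, csInf_Ioi]⟩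

end BoxDim

/-! ### Area of the neighbourhoods of a spiral -/

lemma rpow_one_third_pow_three {ε : ℝ} (hε : 0 < ε) : (ε ^ (1 / 3 : ℝ)) ^ 3 = ε := by
  rw [← Real.rpow_natCast, ← Real.rpow_mul hε.le]
  norm_num

lemma rpow_one_third_sq {ε : ℝ} (hε : 0 < ε) :
    (ε ^ (1 / 3 : ℝ)) ^ 2 = ε ^ (((2 : ℕ) : ℝ) - 4 / 3) := by
  rw [← Real.rpow_natCast, ← Real.rpow_mul hε.le]
  norm_num

/-- A Lipschitz curve `γ : [a, ∞) → ℝ²` with `‖γ s‖ ≤ C / s` has `ε`-neighbourhoods of area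
`O(ε ^ (2 / 3))`: the part `s ≥ ε ^ (-1 / 3)` stays in a disk of radius `O(ε ^ (1 / 3))`, and
the rest is covered by `O(ε ^ (-4 / 3))` disks of radius `O(ε)`. -/
lemma exists_volume_thickening_le {γ : ℝ → EuclideanSpace ℝ (Fin 2)} {a C K : ℝ} (ha : 0 < a)
    (hC : 0 ≤ C) (hK : 0 ≤ K) (hγ : ∀ s, a ≤ s → ‖γ s‖ ≤ C / s)
    (hlip : ∀ s s', a ≤ s → s ≤ s' → dist (γ s) (γ s') ≤ K * (s' - s)) :
    ∃ C', ∀ᶠ ε : ℝ in 𝓝[>] 0, volume (Metric.thickening ε (γ '' Ici a)) ≤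
      ENNReal.ofReal (C' * ε ^ (((2 : ℕ) : ℝ) - 4 / 3)) := by
  refine ⟨(C + 1) ^ 2 * Real.pi + 2 * (K + 1) ^ 2 * Real.pi, ?_⟩
  have h1 : ∀ᶠ ε : ℝ in 𝓝[>] 0, ε ≤ 1 := nhdsWithin_le_nhds (Iic_mem_nhds (by norm_num))
  filter_upwards [self_mem_nhdsWithin, h1] with ε (hε : 0 < ε) hε1
  obtain ⟨η, hη, hη3, hη2⟩ : ∃ η : ℝ, 0 < η ∧ η ^ 3 = ε ∧ η ^ 2 = ε ^ (((2 : ℕ) : ℝ) - 4 / 3) :=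
    ⟨ε ^ (1 / 3 : ℝ), Real.rpow_pos_of_pos hε _, rpow_one_third_pow_three hε, rpow_one_third_sq hε⟩
  rw [← hη2]
  have hη1 : η ≤ 1 := by
    by_contra! h
    have : 1 < η ^ 3 := one_lt_pow₀ h (by norm_num)
    linarith
  have hεη : ε ≤ η := by
    rw [← hη3]
    nlinarith [mul_nonneg hη.le hη.le, mul_le_mul hη1 hη1 hη.le zero_le_one]
  set n : ℕ := ⌈(η ^ 4)⁻¹⌉₊ with hn
  have hcover : Metric.thickening ε (γ '' Ici a) ⊆ Metric.ball 0 ((C + 1) * η) ∪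
      ⋃ j ∈ Finset.range n, Metric.ball (γ (a + j * ε)) ((K + 1) * ε) := by
    intro P hP
    obtain ⟨_, ⟨s, hs, rfl⟩, hPs⟩ := Metric.mem_thickening_iff.1 hP
    have hs : a ≤ s := hs
    have hs0 : 0 < s := ha.trans_le hs
    rcases le_or_gt η⁻¹ s with h | h
    · left
      rw [mem_ball_zero_iff]
      have h2 : C / s ≤ C * η := by
        rw [div_eq_mul_inv]
        exact mul_le_mul_of_nonneg_left (inv_le_of_inv_le₀ hη h) hC
      have h3 : ‖P‖ ≤ dist P (γ s) + ‖γ s‖ := by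
        rw [dist_eq_norm]
        simpa using norm_add_le (P - γ s) (γ s)
      have := hγ s hs
      linarith
    · right
      simp only [mem_iUnion, Finset.mem_range, Metric.mem_ball]
      have hq : 0 ≤ (s - a) / ε := div_nonneg (by linarith) hε.le
      have hj1 := Nat.floor_le hq
      have hj2 := Nat.lt_floor_add_one ((s - a) / ε)
      refine ⟨⌊(s - a) / ε⌋₊, ?_, ?_⟩
      · have : (⌊(s - a) / ε⌋₊ : ℝ) < n := by
          refine hj1.trans_lt (lt_of_lt_of_le ?_ (Nat.le_ceil _))
          rw [div_lt_iff₀ hε, ← hη3]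
          have : (η ^ 4)⁻¹ * η ^ 3 = η⁻¹ := by field_simp
          rw [this]
          linarith
        exact_mod_cast this
      · rw [le_div_iff₀ hε] at hj1
        rw [div_lt_iff₀ hε] at hj2
        set j : ℝ := (⌊(s - a) / ε⌋₊ : ℝ) with hj
        have hj0 : 0 ≤ j := Nat.cast_nonneg _
        have h5 := hlip (a + j * ε) s (by nlinarith) (by linarith)
        have h6 := dist_triangle P (γ s) (γ (a + j * ε))
        rw [dist_comm (γ s)] at h6
        have h7 : K * (s - (a + j * ε)) ≤ K * ε := mul_le_mul_of_nonneg_left (by linarith) hK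
        linarith
  refine (measure_mono hcover).trans ((measure_union_le _ _).trans ?_)
  refine (add_le_add le_rfl (measure_biUnion_finset_le _ _)).trans ?_
  have hball : ∀ (x : EuclideanSpace ℝ (Fin 2)) {r : ℝ}, 0 ≤ r →
      volume (Metric.ball x r) = ENNReal.ofReal (r ^ 2 * Real.pi) := fun x r hr => by
    rw [EuclideanSpace.volume_ball_fin_two, ENNReal.ofReal_mul (by positivity),
      ENNReal.ofReal_pow hr]
  simp only [hball _ (show 0 ≤ (C + 1) * η by positivity),
    hball _ (show 0 ≤ (K + 1) * ε by positivity), Finset.sum_const, Finset.card_range, nsmul_eq_mul]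
  rw [← ENNReal.ofReal_natCast, ← ENNReal.ofReal_mul (Nat.cast_nonneg _),
    ← ENNReal.ofReal_add (by positivity) (by positivity)]
  refine ENNReal.ofReal_le_ofReal ?_
  have hn2 : (n : ℝ) ≤ 2 * (η ^ 4)⁻¹ := by
    have h1 := (Nat.ceil_lt_add_one (show 0 ≤ (η ^ 4)⁻¹ by positivity)).le
    have h2 : 1 ≤ (η ^ 4)⁻¹ := (one_le_inv₀ (by positivity)).2 (pow_le_one₀ hη.le hη1)
    linarith
  have h8 : (n : ℝ) * (((K + 1) * ε) ^ 2 * Real.pi) ≤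
      2 * (η ^ 4)⁻¹ * (((K + 1) * ε) ^ 2 * Real.pi) :=
    mul_le_mul_of_nonneg_right hn2 (by positivity)
  have h9 : 2 * (η ^ 4)⁻¹ * (((K + 1) * ε) ^ 2 * Real.pi) =
      2 * (K + 1) ^ 2 * Real.pi * η ^ 2 := by
    rw [← hη3]
    field_simp
  nlinarith

/-- If each point `P ≠ 0` near the origin is within `O(‖P‖ ^ 3)` of `A`, then the
`ε`-neighbourhood of `A` contains a punctured disk of radius comparable to `ε ^ (1 / 3)`. -/
lemma exists_le_volume_thickening {A : Set (EuclideanSpace ℝ (Fin 2))} {C r₀ : ℝ} (hr₀ : 0 < r₀)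
    (hC : 0 ≤ C) (h : ∀ P, 0 < ‖P‖ → ‖P‖ < r₀ → ∃ Q ∈ A, dist P Q ≤ C * ‖P‖ ^ 3) :
    ∃ c > 0, ∀ᶠ ε : ℝ in 𝓝[>] 0, ENNReal.ofReal (c * ε ^ (((2 : ℕ) : ℝ) - 4 / 3)) ≤
      volume (Metric.thickening ε A) := by
  -- any `k` in `(0, 1]` with `C * k ^ 3 < 1` serves as the ratio of the radius to `ε ^ (1 / 3)`
  set k : ℝ := (C + 1)⁻¹ with hk
  have hk0 : 0 < k := by positivity
  have hk1 : k ≤ 1 := inv_le_one_of_one_le₀ (by linarith)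
  have hCk : C * k ^ 3 < 1 := by
    have h1 : C * k < 1 := by
      rw [hk, ← div_eq_mul_inv, div_lt_one (by linarith)]
      linarith
    have h2 : k ^ 2 ≤ 1 := pow_le_one₀ hk0.le hk1
    nlinarith [mul_nonneg hC hk0.le]
  refine ⟨k ^ 2 * Real.pi, by positivity, ?_⟩
  have h1 : ∀ᶠ ε : ℝ in 𝓝[>] 0, ε < r₀ ^ 3 :=
    nhdsWithin_le_nhds (Iio_mem_nhds (by positivity))
  filter_upwards [self_mem_nhdsWithin, h1] with ε (hε : 0 < ε) hε1
  obtain ⟨η, hη, hη3, hη2⟩ : ∃ η : ℝ, 0 < η ∧ η ^ 3 = ε ∧ η ^ 2 = ε ^ (((2 : ℕ) : ℝ) - 4 / 3) :=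
    ⟨ε ^ (1 / 3 : ℝ), Real.rpow_pos_of_pos hε _, rpow_one_third_pow_three hε, rpow_one_third_sq hε⟩
  rw [← hη2]
  have hηr : η < r₀ := lt_of_pow_lt_pow_left₀ 3 hr₀.le (by rwa [hη3])
  have hsub : Metric.ball 0 (k * η) \ {0} ⊆ Metric.thickening ε A := by
    rintro P ⟨hP, hP0⟩
    rw [mem_ball_zero_iff] at hP
    have hP0 : 0 < ‖P‖ := norm_pos_iff.2 hP0
    obtain ⟨Q, hQ, hPQ⟩ := h P hP0 (by nlinarith)
    refine Metric.mem_thickening_iff.2 ⟨Q, hQ, hPQ.trans_lt ?_⟩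
    calc C * ‖P‖ ^ 3 ≤ C * (k * η) ^ 3 := by gcongr
      _ = C * k ^ 3 * ε := by rw [← hη3]; ring
      _ < ε := by nlinarith
  refine le_trans (le_of_eq ?_) (measure_mono hsub)
  rw [measure_sdiff_null (measure_singleton _), EuclideanSpace.volume_ball_fin_two,
    ← ENNReal.ofReal_pow (by positivity), ← ENNReal.ofReal_mul (by positivity)]
  ring_nf

/-! ### Asymptotics of the solutions of Bessel's equation -/

/-- The function `x` with derivative `x₁` solves Bessel's equation
`t² x'' + t x' + (t² - ν²) x = 0` on `(0, ∞)`. -/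
structure IsBesselSolution (ν : ℝ) (x x₁ : ℝ → ℝ) : Prop where
  hasDerivAt : ∀ t, 0 < t → HasDerivAt x (x₁ t) t
  hasDerivAt' : ∀ t, 0 < t → HasDerivAt x₁ (-(x₁ t) / t - (1 - ν ^ 2 / t ^ 2) * x t) t

/-- A curve in `ℂ` with logarithmic derivative `O(1 / t²)` that does not vanish at some point
converges at infinity to a nonzero limit, with error `O(1 / t)`. -/
lemma exists_limit_of_norm_deriv_le {ζ ζ' : ℝ → ℂ} {k : ℝ} (hk : 0 ≤ k)
    (hζ : ∀ t, 0 < t → HasDerivAt ζ (ζ' t) t) (hb : ∀ t, 0 < t → ‖ζ' t‖ ≤ k / t ^ 2 * ‖ζ t‖)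
    {t₁ τ : ℝ} (ht₁ : 0 < t₁) (hne : ζ t₁ ≠ 0) (hτ : 0 < τ) :
    ∃ Z : ℂ, Z ≠ 0 ∧ ∃ C, 0 ≤ C ∧ ∀ t, τ ≤ t → ‖ζ t - Z‖ ≤ C / t := by
  have hE : ∀ t, 0 < t → HasDerivAt (fun t => ‖ζ t‖ ^ 2) (2 * inner ℝ (ζ t) (ζ' t)) t :=
    fun t ht => (hζ t ht).norm_sq
  have hE' : ∀ t, 0 < t → |2 * inner ℝ (ζ t) (ζ' t)| ≤ 2 * k / t ^ 2 * ‖ζ t‖ ^ 2 := by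
    intro t ht
    rw [abs_mul, abs_two]
    have h1 := abs_real_inner_le_norm (ζ t) (ζ' t)
    have h2 := mul_le_mul_of_nonneg_left (hb t ht) (norm_nonneg (ζ t))
    calc 2 * |inner ℝ (ζ t) (ζ' t)| ≤ 2 * (‖ζ t‖ * (k / t ^ 2 * ‖ζ t‖)) := by linarith
      _ = _ := by ring
  have hexp : ∀ (a t : ℝ), 0 < t →
      HasDerivAt (fun t => Real.exp (a / t)) (Real.exp (a / t) * (-a / t ^ 2)) t := by
    intro a t ht
    have h1 : HasDerivAt (fun t : ℝ => a / t) (-a / t ^ 2) t := by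
      simpa [div_eq_mul_inv, mul_comm, neg_mul] using (hasDerivAt_inv ht.ne').const_mul a
    exact h1.exp
  have hf : ∀ (a t : ℝ), 0 < t → HasDerivAt (fun t => ‖ζ t‖ ^ 2 * Real.exp (a / t))
      ((2 * inner ℝ (ζ t) (ζ' t) - a / t ^ 2 * ‖ζ t‖ ^ 2) * Real.exp (a / t)) t := by
    intro a t ht
    refine ((hE t ht).fun_mul (hexp a t ht)).congr_deriv ?_
    ring
  -- `‖ζ‖ ^ 2` changes at most at the rate `2 k / t ^ 2`, so multiplying it by `exp (±2 k / t)`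
  -- makes it monotone; this bounds it above, and below away from zero
  have hanti : AntitoneOn (fun t => ‖ζ t‖ ^ 2 * Real.exp (2 * k / t)) (Ioi 0) := by
    refine antitoneOn_of_deriv_nonpos (convex_Ioi 0)
      (fun t ht => (hf _ t ht).continuousAt.continuousWithinAt) ?_ ?_
    · rw [interior_Ioi]
      exact fun t ht => (hf _ t ht).differentiableAt.differentiableWithinAt
    · rw [interior_Ioi]
      intro t ht
      rw [(hf _ t ht).deriv]
      exact mul_nonpos_of_nonpos_of_nonneg (by linarith [(abs_le.1 (hE' t ht)).2])
        (Real.exp_pos _).le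
  have hmono : MonotoneOn (fun t => ‖ζ t‖ ^ 2 * Real.exp (-(2 * k) / t)) (Ioi 0) := by
    refine monotoneOn_of_deriv_nonneg (convex_Ioi 0)
      (fun t ht => (hf _ t ht).continuousAt.continuousWithinAt) ?_ ?_
    · rw [interior_Ioi]
      exact fun t ht => (hf _ t ht).differentiableAt.differentiableWithinAt
    · rw [interior_Ioi]
      intro t ht
      rw [(hf _ t ht).deriv]
      refine mul_nonneg ?_ (Real.exp_pos _).le
      have := (abs_le.1 (hE' t ht)).1
      rw [neg_div, neg_mul]
      linarith
  obtain ⟨M, hM0, hM⟩ : ∃ M, 0 ≤ M ∧ ∀ t, τ ≤ t → ‖ζ t‖ ≤ M := by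
    refine ⟨√(‖ζ τ‖ ^ 2 * Real.exp (2 * k / τ)), Real.sqrt_nonneg _, fun t ht => ?_⟩
    refine Real.le_sqrt_of_sq_le (le_trans ?_ (hanti hτ (hτ.trans_le ht) ht))
    exact le_mul_of_one_le_right (by positivity)
      (Real.one_le_exp (div_nonneg (by linarith) (hτ.trans_le ht).le))
  have hlow : ∀ t, t₁ ≤ t → ‖ζ t₁‖ ^ 2 * Real.exp (-(2 * k) / t₁) ≤ ‖ζ t‖ ^ 2 := by
    intro t ht
    refine (hmono ht₁ (ht₁.trans_le ht) ht).trans ?_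
    refine mul_le_of_le_one_right (by positivity) (Real.exp_le_one_iff.2 ?_)
    exact div_nonpos_of_nonpos_of_nonneg (by linarith) (ht₁.trans_le ht).le
  have hdiff : ∀ a b, τ ≤ a → a ≤ b → ‖ζ b - ζ a‖ ≤ k * M * (a⁻¹ - b⁻¹) := by
    intro a b ha hab
    have ha0 : 0 < a := hτ.trans_le ha
    refine image_norm_le_of_norm_deriv_right_le_deriv_boundary' (f := fun t => ζ t - ζ a)
      (f' := ζ') (B := fun t => k * M * (a⁻¹ - t⁻¹)) (B' := fun t => k * M * (t ^ 2)⁻¹)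
      (a := a) (b := b) ?_ ?_ (by simp) ?_ ?_ ?_ (right_mem_Icc.2 hab)
    · exact fun t ht => ((hζ t (ha0.trans_le ht.1)).sub_const _).continuousAt.continuousWithinAt
    · exact fun t ht => ((hζ t (ha0.trans_le ht.1)).sub_const _).hasDerivWithinAt
    · exact fun t ht => (((hasDerivAt_inv (ha0.trans_le ht.1).ne').const_sub
        a⁻¹).const_mul (k * M)).continuousAt.continuousWithinAt
    · intro t ht
      simpa using (((hasDerivAt_inv (ha0.trans_le ht.1).ne').const_sub
        a⁻¹).const_mul (k * M)).hasDerivWithinAt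
    · intro t ht
      have ht0 := ha0.trans_le ht.1
      calc ‖ζ' t‖ ≤ k / t ^ 2 * ‖ζ t‖ := hb t ht0
        _ ≤ k / t ^ 2 * M := mul_le_mul_of_nonneg_left (hM t (ha.trans ht.1)) (by positivity)
        _ = _ := by ring
  have hdiff' : ∀ a b, τ ≤ a → a ≤ b → ‖ζ b - ζ a‖ ≤ k * M * a⁻¹ := fun a b ha hab =>
    (hdiff a b ha hab).trans <| mul_le_mul_of_nonneg_left
      (sub_le_self _ (inv_nonneg.2 (hτ.le.trans (ha.trans hab)))) (mul_nonneg hk hM0)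
  have hcauchy : CauchySeq ζ := by
    have h0 : Tendsto (fun a : ℝ => k * M * a⁻¹) atTop (𝓝 0) := by
      simpa using tendsto_inv_atTop_zero.const_mul (k * M)
    refine Metric.cauchySeq_iff'.2 fun ε hε => ?_
    obtain ⟨a, ha, haε⟩ := ((eventually_ge_atTop τ).and (h0.eventually (Iio_mem_nhds hε))).exists
    exact ⟨a, fun b hb => (dist_eq_norm (ζ b) (ζ a)).trans_lt ((hdiff' a b ha hb).trans_lt haε)⟩
  obtain ⟨Z, hZ⟩ := cauchySeq_tendsto_of_complete hcauchy
  refine ⟨Z, ?_, k * M, mul_nonneg hk hM0, fun t ht => ?_⟩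
  · rintro rfl
    have h1 : Tendsto (fun t => ‖ζ t‖ ^ 2) atTop (𝓝 0) := by simpa using (hZ.norm.pow 2)
    have h2 := ge_of_tendsto h1 ((eventually_ge_atTop t₁).mono hlow)
    have : 0 < ‖ζ t₁‖ ^ 2 * Real.exp (-(2 * k) / t₁) := by positivity
    linarith
  · rw [norm_sub_rev, div_eq_mul_inv]
    refine le_of_tendsto ((hZ.sub_const (ζ t)).norm) ?_
    filter_upwards [eventually_ge_atTop t] with b hb using hdiff' t b ht hb

/-- The Liouville transform `u = √t x` turns Bessel's equation into
`u'' + (1 - (ν² - 1 / 4) / t²) u = 0`; then `ζ = (u + i u') exp (i t)` varies slowly. -/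
lemma IsBesselSolution.exists_asymptotics {ν : ℝ} {x x₁ : ℝ → ℝ} (h : IsBesselSolution ν x x₁)
    {t₁ τ : ℝ} (ht₁ : 0 < t₁) (hne : ¬(x t₁ = 0 ∧ x₁ t₁ = 0)) (hτ : 0 < τ) :
    ∃ Z : ℂ, Z ≠ 0 ∧ ∃ C, 0 ≤ C ∧ ∀ t, τ ≤ t →
      ‖(√t : ℂ) * (x t + x₁ t * Complex.I) - Z * Complex.exp (-(t * Complex.I))‖ ≤ C / t := by
  set u : ℝ → ℝ := fun t => √t * x t with hu
  set v : ℝ → ℝ := fun t => √t * x₁ t + x t / (2 * √t) with hv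
  set c : ℝ := ν ^ 2 - 1 / 4 with hc
  have hsq : ∀ t : ℝ, 0 < t → HasDerivAt (fun t => √t) (1 / (2 * √t)) t := fun t ht =>
    Real.hasDerivAt_sqrt ht.ne'
  have hu' : ∀ t, 0 < t → HasDerivAt u (v t) t := by
    intro t ht
    refine ((hsq t ht).fun_mul (h.hasDerivAt t ht)).congr_deriv ?_
    simp only [hv]
    ring
  have hv' : ∀ t, 0 < t → HasDerivAt v (-u t + c / t ^ 2 * u t) t := by
    intro t ht
    have hs : 0 < √t := Real.sqrt_pos.2 ht
    refine (((hsq t ht).fun_mul (h.hasDerivAt' t ht)).fun_add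
      ((h.hasDerivAt t ht).fun_div ((hsq t ht).const_mul 2) (by positivity))).congr_deriv ?_
    simp only [hu, hc]
    obtain ⟨s, hs', rfl⟩ : ∃ s, 0 < s ∧ t = s ^ 2 := ⟨√t, hs, (Real.sq_sqrt ht.le).symm⟩
    rw [Real.sqrt_sq hs'.le]
    field_simp
    ring
  set ζ : ℝ → ℂ := fun t => (u t + v t * Complex.I) * Complex.exp (t * Complex.I) with hζ
  have hζ' : ∀ t, 0 < t → HasDerivAt ζ
      ((c / t ^ 2 * u t : ℝ) * Complex.I * Complex.exp (t * Complex.I)) t := by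
    intro t ht
    have he : HasDerivAt (fun t : ℝ => Complex.exp (t * Complex.I))
        (Complex.exp (t * Complex.I) * Complex.I) t := by
      have := (((hasDerivAt_id t).ofReal_comp).mul_const Complex.I).cexp
      simpa using this
    refine (((hu' t ht).ofReal_comp.fun_add
      ((hv' t ht).ofReal_comp.mul_const Complex.I)).fun_mul he).congr_deriv ?_
    push_cast
    linear_combination ((v t : ℂ) * Complex.exp (t * Complex.I)) * Complex.I_sq
  have hnexp : ∀ t : ℝ, ‖Complex.exp (t * Complex.I)‖ = 1 := Complex.norm_exp_ofReal_mul_I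
  have hnu : ∀ t, |u t| ≤ ‖ζ t‖ := by
    intro t
    rw [hζ, norm_mul, hnexp, mul_one]
    simpa using Complex.abs_re_le_norm ((u t : ℂ) + v t * Complex.I)
  have hb : ∀ t, 0 < t → ‖((c / t ^ 2 * u t : ℝ) : ℂ) * Complex.I * Complex.exp (t * Complex.I)‖ ≤
      |c| / t ^ 2 * ‖ζ t‖ := by
    intro t ht
    rw [norm_mul, norm_mul, hnexp, Complex.norm_I, mul_one, mul_one, Complex.norm_real,
      Real.norm_eq_abs, abs_mul, abs_div, abs_of_pos (by positivity : 0 < t ^ 2)]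
    exact mul_le_mul_of_nonneg_left (hnu t) (by positivity)
  have hζne : ζ t₁ ≠ 0 := by
    intro h0
    have hs : 0 < √t₁ := Real.sqrt_pos.2 ht₁
    have h1 : (u t₁ : ℂ) + v t₁ * Complex.I = 0 := by
      simpa [hζ, Complex.exp_ne_zero] using h0
    have h2 : u t₁ = 0 := by simpa using congrArg Complex.re h1
    have h3 : v t₁ = 0 := by simpa using congrArg Complex.im h1
    have h4 : x t₁ = 0 := by simpa [hu, hs.ne'] using h2
    exact hne ⟨h4, by simpa [hv, h4, hs.ne'] using h3⟩
  obtain ⟨Z, hZ, C, hC, hlim⟩ := exists_limit_of_norm_deriv_le (abs_nonneg c) hζ' hb ht₁ hζne hτ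
  refine ⟨Z, hZ, C + (‖Z‖ + C / τ) / 2, by positivity, fun t ht => ?_⟩
  have ht0 : 0 < t := hτ.trans_le ht
  have hs : 0 < √t := Real.sqrt_pos.2 ht0
  have hee : Complex.exp (t * Complex.I) * Complex.exp (-(t * Complex.I)) = 1 := by
    rw [← Complex.exp_add]
    simp
  have hkey : (√t : ℂ) * (x t + x₁ t * Complex.I) - Z * Complex.exp (-(t * Complex.I)) =
      (ζ t - Z) * Complex.exp (((-t : ℝ) : ℂ) * Complex.I) -
        ((u t / (2 * t) : ℝ) : ℂ) * Complex.I := by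
    have h1 : √t * x₁ t = v t - u t / (2 * t) := by
      simp only [hu, hv]
      obtain ⟨s, hs', rfl⟩ : ∃ s, 0 < s ∧ t = s ^ 2 := ⟨√t, hs, (Real.sq_sqrt ht0.le).symm⟩
      rw [Real.sqrt_sq hs'.le]
      field_simp
      ring
    have h2 : (√t : ℂ) * x₁ t = v t - ((u t / (2 * t) : ℝ) : ℂ) := by exact_mod_cast h1
    have h3 : (√t : ℂ) * x t = u t := by simp [hu]
    have h4 : (((-t : ℝ) : ℂ) * Complex.I) = -(t * Complex.I) := by push_cast; ring
    rw [h4]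
    simp only [hζ]
    linear_combination h3 + Complex.I * h2 - (u t + v t * Complex.I) * hee
  have hut : |u t| ≤ ‖Z‖ + C / τ := by
    have h1 : ‖ζ t‖ ≤ ‖ζ t - Z‖ + ‖Z‖ := by simpa using norm_add_le (ζ t - Z) Z
    have h2 : C / t ≤ C / τ := div_le_div_of_nonneg_left hC hτ ht
    linarith [hnu t, hlim t ht]
  rw [hkey]
  refine (norm_sub_le _ _).trans ?_
  rw [norm_mul, hnexp, norm_mul, Complex.norm_I, Complex.norm_real, Real.norm_eq_abs, abs_div,
    abs_of_pos (by positivity : 0 < 2 * t), mul_one, mul_one]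
  calc ‖ζ t - Z‖ + |u t| / (2 * t) ≤ C / t + (‖Z‖ + C / τ) / (2 * t) := by
        gcongr
        exact hlim t ht
    _ = _ := by field_simp

/-! ### Phase dimension of a solution of Bessel's equation -/

lemma norm_toLp_eq_norm_add_mul_I (a b : ℝ) :
    ‖(!₂[a, b] : EuclideanSpace ℝ (Fin 2))‖ = ‖(a + b * Complex.I : ℂ)‖ := by
  rw [Complex.norm_add_mul_I, EuclideanSpace.norm_eq]
  simp

lemma dist_toLp_eq_norm_sub (a b c d : ℝ) :
    dist (!₂[a, b] : EuclideanSpace ℝ (Fin 2)) (!₂[c, d]) =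
      ‖(a + b * Complex.I : ℂ) - (c + d * Complex.I)‖ := by
  have h : (a + b * Complex.I : ℂ) - (c + d * Complex.I) =
      ((a - c : ℝ) : ℂ) + ((b - d : ℝ) : ℂ) * Complex.I := by
    push_cast
    ring
  rw [h, ← norm_toLp_eq_norm_add_mul_I, dist_eq_norm]
  congr 1
  ext i
  fin_cases i <;> simp

/-- Points `z` near `0` are within `O(‖z‖ ^ 3)` of the spiral `t ↦ t ^ (-1 / 2) Z exp (-i t)` and
of its perturbations of relative size `O(1 / t)`: on the first turn after `t₀ = (‖Z‖ / ‖z‖) ^ 2`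
there is a time at which the spiral has the argument of `z`. -/
lemma exists_norm_sub_le_of_spiral {w : ℝ → ℂ} {Z : ℂ} {C τ : ℝ} (hZ : Z ≠ 0) (hτ : 0 < τ)
    (hC : 0 ≤ C) (hw : ∀ t, τ ≤ t →
      ‖(√t : ℂ) * w t - Z * Complex.exp (-(t * Complex.I))‖ ≤ C / t)
    {z : ℂ} (hz : z ≠ 0) (hz' : ‖z‖ < ‖Z‖ / √τ) :
    ∃ t, τ ≤ t ∧ ‖z - w t‖ ≤ (Real.pi / ‖Z‖ ^ 2 + C / ‖Z‖ ^ 3) * ‖z‖ ^ 3 := by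
  have hA : 0 < ‖Z‖ := norm_pos_iff.2 hZ
  have hρ : 0 < ‖z‖ := norm_pos_iff.2 hz
  obtain ⟨σ, hσ⟩ : ∃ σ, σ = ‖Z‖ / ‖z‖ := ⟨_, rfl⟩
  have hσ0 : 0 < σ := hσ ▸ div_pos hA hρ
  have hτσ : τ < σ ^ 2 := by
    have hs : 0 < √τ := Real.sqrt_pos.2 hτ
    have h1 : √τ < σ := by
      rw [lt_div_iff₀ hs] at hz'
      rw [hσ, lt_div_iff₀ hρ]
      linarith
    nlinarith [Real.sq_sqrt hτ.le]
  -- `t` is the time in `[t₀, t₀ + 2π)`, `t₀ = σ ^ 2`, at which `Z exp (-i t)` has the argument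
  -- of `z`
  set θ : ℝ := (z / Z).arg with hθ
  set t : ℝ := toIcoMod Real.two_pi_pos (σ ^ 2) (-θ) with ht
  have ht1 : σ ^ 2 ≤ t := left_le_toIcoMod _ _ _
  have ht2 : t < σ ^ 2 + 2 * Real.pi := toIcoMod_lt_right _ _ _
  have htτ : τ ≤ t := hτσ.le.trans ht1
  have hexp : Complex.exp (-(t * Complex.I)) = Complex.exp (θ * Complex.I) := by
    rw [Complex.exp_eq_exp_iff_exists_int]
    refine ⟨toIcoDiv Real.two_pi_pos (σ ^ 2) (-θ), ?_⟩
    have h1 : t = -θ - toIcoDiv Real.two_pi_pos (σ ^ 2) (-θ) * (2 * Real.pi) := by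
      rw [ht, toIcoMod, zsmul_eq_mul]
    rw [h1]
    push_cast
    ring
  have hzσ : z = Z * Complex.exp (θ * Complex.I) / σ := by
    have h1 := Complex.norm_mul_exp_arg_mul_I (z / Z)
    rw [← hθ, norm_div] at h1
    have h2 : ((‖z‖ / ‖Z‖ : ℝ) : ℂ) = 1 / σ := by
      rw [hσ]
      push_cast
      rw [one_div_div]
    rw [h2] at h1
    field_simp at h1 ⊢
    rw [← h1]
  obtain ⟨r, hr0, hrt⟩ : ∃ r, 0 < r ∧ t = r ^ 2 :=
    ⟨√t, Real.sqrt_pos.2 (hτ.trans_le htτ), (Real.sq_sqrt (hτ.le.trans htτ)).symm⟩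
  have hrσ : σ ≤ r := by
    rw [hrt] at ht1
    exact le_of_sq_le_sq ht1 hr0.le
  have hwt := hw t htτ
  rw [hexp, hrt, Real.sqrt_sq hr0.le, ← hrt] at hwt
  refine ⟨t, htτ, ?_⟩
  have hsplit : z - w t = Z * Complex.exp (θ * Complex.I) * ((1 / σ - 1 / r : ℝ) : ℂ) -
      ((1 / r : ℝ) : ℂ) * (r * w t - Z * Complex.exp (θ * Complex.I)) := by
    have : (r : ℂ) ≠ 0 := by exact_mod_cast hr0.ne'
    rw [hzσ]
    push_cast
    field_simp
    ring
  have hd0 : 0 ≤ 1 / σ - 1 / r := sub_nonneg.2 (one_div_le_one_div_of_le hσ0 hrσ)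
  have hd : 1 / σ - 1 / r ≤ Real.pi / σ ^ 3 := by
    have h1 : (r - σ) * (2 * σ) ≤ 2 * Real.pi := by nlinarith
    have h2 : 1 / σ - 1 / r = (r - σ) / (σ * r) := by field_simp
    rw [h2]
    calc (r - σ) / (σ * r) ≤ (r - σ) / (σ * σ) := by
          apply div_le_div_of_nonneg_left (sub_nonneg.2 hrσ) (by positivity)
          gcongr
      _ = (r - σ) * σ / σ ^ 3 := by field_simp
      _ ≤ Real.pi / σ ^ 3 := by
          gcongr
          linarith
  have hr3 : 1 / r * (C / r ^ 2) ≤ C / σ ^ 3 := by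
    calc 1 / r * (C / r ^ 2) = C / r ^ 3 := by field_simp
      _ ≤ C / σ ^ 3 := by gcongr
  rw [hrt] at hwt
  rw [hsplit]
  refine (norm_sub_le _ _).trans ?_
  rw [norm_mul, norm_mul, norm_mul, Complex.norm_exp_ofReal_mul_I, Complex.norm_real,
    Complex.norm_real, Real.norm_of_nonneg hd0, Real.norm_of_nonneg (by positivity), mul_one]
  calc _ ≤ ‖Z‖ * (Real.pi / σ ^ 3) + 1 / r * (C / r ^ 2) := by
        rw [hrt]
        gcongr
    _ ≤ ‖Z‖ * (Real.pi / σ ^ 3) + C / σ ^ 3 := by gcongr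
    _ = _ := by
        rw [hσ]
        field_simp

lemma IsBesselSolution.phaseCurve_eq {ν τ : ℝ} {x x₁ : ℝ → ℝ} (h : IsBesselSolution ν x x₁)
    (hτ : 0 < τ) : phaseCurve x τ = (fun t : ℝ => !₂[x t, x₁ t]) '' Ici τ := by
  refine image_congr fun t ht => ?_
  rw [(h.hasDerivAt t (hτ.trans_le ht)).hasDerivWithinAt.derivWithin
    (uniqueDiffOn_Ici τ t ht)]

/-- The phase dimension of every nontrivial solution of Bessel's equation is `4 / 3`. -/
theorem IsBesselSolution.hasPhaseDim {ν τ : ℝ} {x x₁ : ℝ → ℝ} (h : IsBesselSolution ν x x₁)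
    {t₁ : ℝ} (ht₁ : 0 < t₁) (hne : ¬(x t₁ = 0 ∧ x₁ t₁ = 0)) (hτ : 0 < τ) :
    HasPhaseDim x τ (4 / 3) := by
  obtain ⟨Z, hZ, C, hC, hasym⟩ := h.exists_asymptotics ht₁ hne hτ
  set w : ℝ → ℂ := fun t => x t + x₁ t * Complex.I with hw
  have hsτ : 0 < √τ := Real.sqrt_pos.2 hτ
  obtain ⟨M, hM0, hM⟩ : ∃ M, 0 ≤ M ∧ ∀ t, τ ≤ t → √t * ‖w t‖ ≤ M := by
    refine ⟨‖Z‖ + C / τ, by positivity, fun t ht => ?_⟩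
    have h1 := norm_add_le ((√t : ℂ) * w t - Z * Complex.exp (-(t * Complex.I)))
      (Z * Complex.exp (((-t : ℝ) : ℂ) * Complex.I))
    rw [norm_mul Z, Complex.norm_exp_ofReal_mul_I] at h1
    have h2 : ((-t : ℝ) : ℂ) * Complex.I = -(t * Complex.I) := by push_cast; ring
    rw [h2, sub_add_cancel, norm_mul, Complex.norm_real,
      Real.norm_of_nonneg (Real.sqrt_nonneg t)] at h1
    have h3 : C / t ≤ C / τ := div_le_div_of_nonneg_left hC hτ ht
    linarith [hasym t ht]
  have hcurve := h.phaseCurve_eq hτ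
  -- in the parameter `s = √t` the curve has bounded speed, since its speed in `t` is `O(1 / √t)`
  have hcurve' : phaseCurve x τ = (fun s : ℝ => !₂[x (s ^ 2), x₁ (s ^ 2)]) '' Ici √τ := by
    rw [hcurve]
    ext P
    constructor
    · rintro ⟨t, ht, rfl⟩
      exact ⟨√t, Real.sqrt_le_sqrt ht, by simp only [Real.sq_sqrt (hτ.le.trans ht)]⟩
    · rintro ⟨s, hs, rfl⟩
      exact ⟨s ^ 2, Real.sqrt_le_iff.1 hs |>.2, rfl⟩
  have hbound : ∀ s, √τ ≤ s → ‖(!₂[x (s ^ 2), x₁ (s ^ 2)] : EuclideanSpace ℝ (Fin 2))‖ ≤ M / s := by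
    intro s hs
    have hs0 : 0 < s := hsτ.trans_le hs
    have := hM (s ^ 2) (Real.sqrt_le_iff.1 hs).2
    rw [Real.sqrt_sq hs0.le] at this
    rw [norm_toLp_eq_norm_add_mul_I, le_div_iff₀ hs0, mul_comm]
    exact this
  set L : ℝ := 1 + (1 / τ + (1 + ν ^ 2 / τ ^ 2)) with hL
  have hL0 : 0 ≤ L := by positivity
  have hderiv : ∀ s, √τ ≤ s → HasDerivAt (fun s => w (s ^ 2))
      ((2 * s : ℝ) • ((x₁ (s ^ 2) : ℂ) +
        ((-(x₁ (s ^ 2)) / s ^ 2 - (1 - ν ^ 2 / (s ^ 2) ^ 2) * x (s ^ 2) : ℝ) : ℂ) *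
          Complex.I)) s := by
    intro s hs
    have hs0 : 0 < s ^ 2 := pow_pos (hsτ.trans_le hs) 2
    have h1 : HasDerivAt w _ (s ^ 2) := (h.hasDerivAt _ hs0).ofReal_comp.fun_add
      ((h.hasDerivAt' _ hs0).ofReal_comp.mul_const Complex.I)
    have h2 : HasDerivAt (fun s : ℝ => s ^ 2) (2 * s) s := by simpa using hasDerivAt_pow 2 s
    exact HasDerivAt.scomp (h := fun s : ℝ => s ^ 2) s h1 h2
  have hspeed : ∀ s, √τ ≤ s → ‖(2 * s : ℝ) • ((x₁ (s ^ 2) : ℂ) +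
      ((-(x₁ (s ^ 2)) / s ^ 2 - (1 - ν ^ 2 / (s ^ 2) ^ 2) * x (s ^ 2) : ℝ) : ℂ) * Complex.I)‖ ≤
      2 * L * M := by
    intro s hs
    have hs0 : 0 < s := hsτ.trans_le hs
    have hsτ' : τ ≤ s ^ 2 := (Real.sqrt_le_iff.1 hs).2
    have hM' := hM (s ^ 2) hsτ'
    rw [Real.sqrt_sq hs0.le] at hM'
    have hx : |x (s ^ 2)| ≤ ‖w (s ^ 2)‖ := by
      simpa [hw] using Complex.abs_re_le_norm (w (s ^ 2))
    have hx₁ : |x₁ (s ^ 2)| ≤ ‖w (s ^ 2)‖ := by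
      simpa [hw] using Complex.abs_im_le_norm (w (s ^ 2))
    rw [norm_smul, Real.norm_of_nonneg (by positivity)]
    have h3 : |-(x₁ (s ^ 2)) / s ^ 2 - (1 - ν ^ 2 / (s ^ 2) ^ 2) * x (s ^ 2)| ≤
        (1 / τ + (1 + ν ^ 2 / τ ^ 2)) * ‖w (s ^ 2)‖ := by
      refine (abs_sub _ _).trans ?_
      rw [add_mul]
      refine add_le_add ?_ ?_
      · rw [abs_div, abs_neg, abs_of_pos (pow_pos hs0 2)]
        calc |x₁ (s ^ 2)| / s ^ 2 ≤ ‖w (s ^ 2)‖ / τ := by gcongr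
          _ = _ := by ring
      · rw [abs_mul]
        refine mul_le_mul ?_ hx (abs_nonneg _) (by positivity)
        refine (abs_sub _ _).trans ?_
        rw [abs_one, abs_of_nonneg (by positivity)]
        gcongr
    calc 2 * s * ‖_‖ ≤ 2 * s * (L * ‖w (s ^ 2)‖) := by
          gcongr
          refine (norm_add_le _ _).trans ?_
          rw [norm_mul, Complex.norm_I, mul_one, Complex.norm_real, Complex.norm_real,
            Real.norm_eq_abs, Real.norm_eq_abs, hL, add_mul 1, one_mul]
          exact add_le_add hx₁ h3
      _ = 2 * L * (s * ‖w (s ^ 2)‖) := by ring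
      _ ≤ 2 * L * M := by gcongr
  have hlip : ∀ s s', √τ ≤ s → s ≤ s' →
      dist (!₂[x (s ^ 2), x₁ (s ^ 2)] : EuclideanSpace ℝ (Fin 2)) (!₂[x (s' ^ 2), x₁ (s' ^ 2)]) ≤
        2 * L * M * (s' - s) := by
    intro s s' hs hss'
    rw [dist_toLp_eq_norm_sub, norm_sub_rev]
    have := Convex.norm_image_sub_le_of_norm_hasDerivWithin_le (f := fun s => w (s ^ 2))
      (s := Ici √τ) (fun s hs => (hderiv s hs).hasDerivWithinAt) hspeed (convex_Ici _) hs
      (hs.trans hss')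
    rwa [Real.norm_of_nonneg (by linarith)] at this
  have hlow : ∀ P : EuclideanSpace ℝ (Fin 2), 0 < ‖P‖ → ‖P‖ < ‖Z‖ / √τ →
      ∃ Q ∈ phaseCurve x τ, dist P Q ≤ (Real.pi / ‖Z‖ ^ 2 + C / ‖Z‖ ^ 3) * ‖P‖ ^ 3 := by
    intro P hP0 hP
    have hPeq : P = !₂[P 0, P 1] := by
      ext i
      fin_cases i <;> simp
    have hnorm : ‖P‖ = ‖(P 0 + P 1 * Complex.I : ℂ)‖ := by
      conv_lhs => rw [hPeq]
      exact norm_toLp_eq_norm_add_mul_I _ _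
    rw [hnorm] at hP0 hP ⊢
    obtain ⟨t, ht, hdist⟩ :=
      exists_norm_sub_le_of_spiral hZ hτ hC hasym (norm_pos_iff.1 hP0) hP
    refine ⟨!₂[x t, x₁ t], hcurve ▸ ⟨t, ht, rfl⟩, ?_⟩
    conv_lhs => rw [hPeq]
    rw [dist_toLp_eq_norm_sub]
    exact hdist
  obtain ⟨c, hc, hlb⟩ := exists_le_volume_thickening (by positivity) (by positivity) hlow
  obtain ⟨C', hub⟩ := exists_volume_thickening_le hsτ hM0 (by positivity) hbound hlip
  rw [← hcurve'] at hub
  refine ⟨?_, hasBoxDim_of_volume_thickening_bounds ?_ (by norm_num) hc hlb hub⟩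
  · have h1 : ContDiffOn ℝ 1 x (Ioi 0) := by
      rw [show (1 : WithTop ℕ∞) = 0 + 1 from rfl, contDiffOn_succ_iff_deriv_of_isOpen isOpen_Ioi]
      refine ⟨fun t ht => (h.hasDerivAt t ht).differentiableAt.differentiableWithinAt,
        by simp, ?_⟩
      rw [contDiffOn_zero]
      refine ContinuousOn.congr (f := x₁)
        (fun t ht => (h.hasDerivAt' t ht).continuousAt.continuousWithinAt) ?_
      exact fun t ht => (h.hasDerivAt t ht).deriv
    exact h1.mono fun t ht => hτ.trans_le ht
  · refine isBounded_iff_forall_norm_le.2 ⟨M / √τ, ?_⟩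
    rw [hcurve']
    rintro _ ⟨s, hs, rfl⟩
    exact (hbound s hs).trans (div_le_div_of_nonneg_left hM0 hsτ hs)

/-! ### The reciprocal Gamma function and the power series of `J_ν` -/

/-- The values of `1 / Γ` at `s + 1, s + 2, …` are bounded, locally uniformly in `s`: they do not
increase in modulus once `‖s + k + 1‖ ≥ 1`, since `1 / Γ(w + 1) = (1 / Γ(w)) / w`. -/
lemma exists_norm_inv_Gamma_le (R : ℝ) :
    ∃ M, 0 ≤ M ∧ ∀ s : ℂ, ‖s‖ ≤ R → ∀ k : ℕ, ‖(Complex.Gamma (s + k + 1))⁻¹‖ ≤ M := by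
  obtain ⟨M, hM⟩ := (isCompact_closedBall (0 : ℂ) (R + ⌈R⌉₊ + 1)).exists_bound_of_continuousOn
    Complex.differentiable_one_div_Gamma.continuous.continuousOn
  have key : ∀ s : ℂ, ‖s‖ ≤ R → ∀ k : ℕ, ‖(Complex.Gamma (s + k + 1))⁻¹‖ ≤ M := by
    intro s hs k
    have hsmall : ∀ k : ℕ, k ≤ ⌈R⌉₊ → ‖(Complex.Gamma (s + k + 1))⁻¹‖ ≤ M := by
      intro k hk
      refine hM _ (mem_closedBall_zero_iff.2 ?_)
      have h1 : ‖s + k + 1‖ ≤ ‖s‖ + k + 1 := by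
        simpa using norm_add₃_le (a := s) (b := (k : ℂ)) (c := 1)
      have h2 : (k : ℝ) ≤ ⌈R⌉₊ := by exact_mod_cast hk
      linarith
    induction k with
    | zero => exact hsmall 0 (Nat.zero_le _)
    | succ k ih =>
      rcases le_or_gt (k + 1) ⌈R⌉₊ with h | h
      · exact hsmall _ h
      · refine le_trans ?_ ih
        have hkR : R ≤ k := (Nat.le_ceil R).trans (by exact_mod_cast Nat.lt_succ_iff.1 h)
        have h1 : 1 ≤ ‖s + k + 1‖ := by
          have h2 : ‖((k + 1 : ℝ) : ℂ)‖ ≤ ‖s + k + 1‖ + ‖s‖ := by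
            have := norm_sub_le (s + k + 1) s
            rwa [show s + k + 1 - s = ((k + 1 : ℝ) : ℂ) by push_cast; ring] at this
          rw [Complex.norm_real, Real.norm_of_nonneg (by positivity)] at h2
          linarith
        rw [Complex.one_div_Gamma_eq_self_mul_one_div_Gamma_add_one (s + k + 1), norm_mul,
          show s + ((k + 1 : ℕ) : ℂ) + 1 = s + k + 1 + 1 by push_cast; ring]
        exact le_mul_of_one_le_left (norm_nonneg _) h1
  refine ⟨max M 0, le_max_right _ _, fun s hs k => (key s hs k).trans (le_max_left _ _)⟩

lemma Real.inv_Gamma_eq_self_mul_inv_Gamma_add_one (s : ℝ) :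
    (Real.Gamma s)⁻¹ = s * (Real.Gamma (s + 1))⁻¹ := by
  have := Complex.one_div_Gamma_eq_self_mul_one_div_Gamma_add_one s
  rw [← Complex.ofReal_one, ← Complex.ofReal_add, Complex.Gamma_ofReal,
    Complex.Gamma_ofReal] at this
  exact_mod_cast this

/-- The `k`-th term of the power series `besselG`. -/
noncomputable def besselTerm (ν z : ℝ) (k : ℕ) : ℝ :=
  (-1) ^ k / ((k ! : ℝ) * Real.Gamma (ν + k + 1)) * z ^ k

/-- The entire function `G_ν(z) = ∑ₖ (-1)ᵏ zᵏ / (k! Γ(ν + k + 1))`, for which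
`J_ν(t) = (t / 2) ^ ν G_ν((t / 2) ^ 2)`. -/
noncomputable def besselG (ν z : ℝ) : ℝ := ∑' k, besselTerm ν z k

lemma besselJ_eq (ν t : ℝ) : besselJ ν t = (t / 2) ^ ν * besselG ν ((t / 2) ^ 2) := by
  simp only [besselJ, besselG, besselTerm, pow_mul]

lemma exists_abs_inv_Gamma_le (ν : ℝ) :
    ∃ M, 0 ≤ M ∧ ∀ k : ℕ, |(Real.Gamma (ν + k + 1))⁻¹| ≤ M := by
  obtain ⟨M, hM0, hM⟩ := exists_norm_inv_Gamma_le |ν|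
  refine ⟨M, hM0, fun k => ?_⟩
  have := hM ν (by simp) k
  rwa [show (ν : ℂ) + k + 1 = ((ν + k + 1 : ℝ) : ℂ) by push_cast; ring, Complex.Gamma_ofReal,
    ← Complex.ofReal_inv, Complex.norm_real] at this

lemma summable_besselTerm (ν z : ℝ) : Summable (besselTerm ν z) := by
  obtain ⟨M, hM0, hM⟩ := exists_abs_inv_Gamma_le ν
  refine Summable.of_norm_bounded ((Real.summable_pow_div_factorial |z|).mul_left M) fun k => ?_
  have h : besselTerm ν z k = (-1) ^ k * (Real.Gamma (ν + k + 1))⁻¹ * (z ^ k / k !) := by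
    rw [besselTerm, mul_comm (k ! : ℝ), div_mul_eq_div_div]
    ring
  rw [h, norm_mul, norm_mul, norm_div, norm_pow, norm_neg, norm_one, one_pow, one_mul, norm_pow,
    RCLike.norm_natCast]
  exact mul_le_mul_of_nonneg_right (hM k) (by positivity)

lemma hasSum_besselTerm (ν z : ℝ) : HasSum (besselTerm ν z) (besselG ν z) :=
  (summable_besselTerm ν z).hasSum

lemma besselTerm_succ (ν z : ℝ) (k : ℕ) :
    (k + 1 : ℝ) * besselTerm ν z (k + 1) = -z * besselTerm (ν + 1) z k := by
  have h1 : (k + 1 : ℝ) ≠ 0 := by positivity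
  have h2 : (k ! : ℝ) ≠ 0 := by positivity
  simp only [besselTerm, Nat.factorial_succ, div_eq_mul_inv, mul_inv]
  rw [show ν + ((k + 1 : ℕ) : ℝ) + 1 = ν + 1 + k + 1 by push_cast; ring]
  push_cast
  field_simp
  ring

lemma hasSum_mul_besselTerm (ν z : ℝ) :
    HasSum (fun k : ℕ => (k : ℝ) * besselTerm ν z k) (-z * besselG (ν + 1) z) := by
  have h := (hasSum_besselTerm (ν + 1) z).mul_left (-z)
  rw [← hasSum_nat_add_iff' 1]
  simpa [besselTerm_succ] using h

lemma besselG_recurrence (ν z : ℝ) :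
    besselG (ν - 1) z = ν * besselG ν z - z * besselG (ν + 1) z := by
  have h := ((hasSum_besselTerm ν z).mul_left ν).add (hasSum_mul_besselTerm ν z)
  have hterm : ∀ k : ℕ, besselTerm (ν - 1) z k = ν * besselTerm ν z k + k * besselTerm ν z k := by
    intro k
    have := Real.inv_Gamma_eq_self_mul_inv_Gamma_add_one (ν + k)
    simp only [besselTerm, div_eq_mul_inv, mul_inv]
    rw [show ν - 1 + k + 1 = ν + k by ring, this]
    ring
  rw [besselG, (h.congr_fun hterm).tsum_eq]
  ring

lemma hasDerivAt_besselG (ν z : ℝ) : HasDerivAt (besselG ν) (-besselG (ν + 1) z) z := by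
  obtain ⟨M, hM0, hM⟩ := exists_abs_inv_Gamma_le ν
  set a : ℕ → ℝ := fun k => (-1) ^ k / ((k ! : ℝ) * Real.Gamma (ν + k + 1)) with ha
  have ha' : ∀ k, |a k| ≤ M / k ! := by
    intro k
    simp only [ha, abs_div, abs_mul, abs_pow, abs_neg, abs_one, one_pow, Nat.abs_cast]
    rw [mul_comm, one_div, mul_inv, ← abs_inv, ← div_eq_mul_inv]
    exact div_le_div_of_nonneg_right (hM k) (by positivity)
  set R : ℝ := |z| + 1 with hR
  have hu : Summable fun k : ℕ => M * (k * R ^ (k - 1) / k !) := by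
    refine Summable.mul_left M ((summable_nat_add_iff 1).1 ?_)
    refine (Real.summable_pow_div_factorial R).congr fun k => ?_
    rw [Nat.factorial_succ, Nat.add_sub_cancel]
    push_cast
    field_simp
  have hz : z ∈ Metric.ball (0 : ℝ) R := by simp [hR]
  have key := hasDerivAt_tsum_of_isPreconnected (g := fun k y => a k * y ^ k)
    (g' := fun k y => a k * (k * y ^ (k - 1))) (y := z) (y₀ := z) hu
    Metric.isOpen_ball (convex_ball (0 : ℝ) R).isPreconnected
    (fun k y _ => (hasDerivAt_pow k y).const_mul (a k)) (fun k y hy => ?_) hz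
    (summable_besselTerm ν z) hz
  · refine key.congr_deriv (HasSum.tsum_eq ?_)
    rw [← hasSum_nat_add_iff' 1]
    have h := (hasSum_besselTerm (ν + 1) z).neg
    simp only [Finset.sum_range_one, CharP.cast_eq_zero, zero_mul, mul_zero, sub_zero]
    refine h.congr_fun fun k => ?_
    simp only [ha, besselTerm, Nat.factorial_succ, div_eq_mul_inv, mul_inv, Nat.add_sub_cancel]
    rw [show ν + ((k + 1 : ℕ) : ℝ) + 1 = ν + 1 + k + 1 by push_cast; ring]
    have h2 : (k + 1 : ℝ) ≠ 0 := by positivity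
    push_cast
    field_simp
    ring
  · rw [mem_ball_zero_iff, Real.norm_eq_abs] at hy
    rw [norm_mul, norm_mul, norm_pow, RCLike.norm_natCast, Real.norm_eq_abs, Real.norm_eq_abs]
    calc |a k| * (k * |y| ^ (k - 1)) ≤ M / k ! * (k * R ^ (k - 1)) := by
          gcongr
          exact ha' k
      _ = _ := by ring

lemma besselG_zero (ν : ℝ) : besselG ν 0 = (Real.Gamma (ν + 1))⁻¹ := by
  rw [besselG, tsum_eq_single 0]
  · simp [besselTerm]
  · intro k hk
    simp [besselTerm, hk]

/-- The Wronskian of `J_s` and `J_{-s}`, in terms of the power series. -/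
lemma besselG_wronskian (s z : ℝ) :
    besselG (s - 1) z * besselG (-s) z + z * (besselG s z * besselG (1 - s) z) =
      Real.sin (Real.pi * s) / Real.pi := by
  have hder : ∀ z, HasDerivAt (fun z => besselG (s - 1) z * besselG (-s) z +
      z * (besselG s z * besselG (1 - s) z)) 0 z := by
    intro z
    have h1 := hasDerivAt_besselG (s - 1) z
    have h2 := hasDerivAt_besselG (-s) z
    have h3 := hasDerivAt_besselG s z
    have h4 := hasDerivAt_besselG (1 - s) z
    rw [sub_add_cancel] at h1
    rw [neg_add_eq_sub] at h2
    refine ((h1.fun_mul h2).fun_add ((hasDerivAt_id' z).fun_mul (h3.fun_mul h4))).congr_deriv ?_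
    have r1 := besselG_recurrence s z
    have r2 := besselG_recurrence (1 - s) z
    rw [show 1 - s - 1 = -s by ring] at r2
    linear_combination besselG (1 - s) z * (-r1) - besselG s z * r2
  -- at `z = 0` the constant is `1 / (Γ(s) Γ(1 - s))`
  have hconst := is_const_of_deriv_eq_zero (fun z => (hder z).differentiableAt)
    (fun z => (hder z).deriv) z 0
  simp only [zero_mul, add_zero, besselG_zero, sub_add_cancel, neg_add_eq_sub] at hconst
  rw [hconst, ← mul_inv, Real.Gamma_mul_Gamma_one_sub, inv_div]

/-! ### Recurrences, Wronskian and parity for `J_ν` -/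

lemma besselJ_sub_one {t : ℝ} (ht : 0 < t) (ν : ℝ) :
    besselJ (ν - 1) t = 2 * ν / t * besselJ ν t - besselJ (ν + 1) t := by
  have h2 : 0 < t / 2 := by positivity
  rw [besselJ_eq, besselJ_eq, besselJ_eq, besselG_recurrence, Real.rpow_sub_one h2.ne',
    Real.rpow_add_one h2.ne']
  field_simp

lemma hasDerivAt_besselJ {t : ℝ} (ht : 0 < t) (ν : ℝ) :
    HasDerivAt (besselJ ν) (ν / t * besselJ ν t - besselJ (ν + 1) t) t := by
  have h2 : 0 < t / 2 := by positivity
  have h3 : HasDerivAt (fun t : ℝ => t / 2) (1 / 2) t := (hasDerivAt_id' t).div_const 2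
  have h4 := HasDerivAt.comp (h := fun t : ℝ => (t / 2) ^ 2) t
    (hasDerivAt_besselG ν ((t / 2) ^ 2)) (h3.fun_pow 2)
  have h5 := (h3.rpow_const (p := ν) (Or.inl h2.ne')).fun_mul h4
  rw [show besselJ ν = fun t => (t / 2) ^ ν * besselG ν ((t / 2) ^ 2) from
    funext (besselJ_eq ν)]
  refine h5.congr_deriv ?_
  rw [Function.comp_apply, besselJ_eq, Real.rpow_sub_one h2.ne', Real.rpow_add_one h2.ne']
  field_simp
  ring

lemma besselJ_wronskian {t : ℝ} (ht : 0 < t) (s : ℝ) :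
    besselJ (s - 1) t * besselJ (-s) t + besselJ s t * besselJ (1 - s) t =
      2 * Real.sin (s * Real.pi) / (Real.pi * t) := by
  have h2 : 0 < t / 2 := by positivity
  have hw := besselG_wronskian s ((t / 2) ^ 2)
  have h3 : (t / 2) ^ (s - 1) * (t / 2) ^ (-s) = 2 / t := by
    rw [← Real.rpow_add h2, show s - 1 + -s = -1 by ring, Real.rpow_neg_one, inv_div]
  have h4 : (t / 2) ^ s * (t / 2) ^ (1 - s) = t / 2 := by
    rw [← Real.rpow_add h2, add_sub_cancel, Real.rpow_one]
  have h5 : 2 / t * ((t / 2) ^ 2) = t / 2 := by field_simp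
  have h6 : 2 * Real.sin (s * Real.pi) / (Real.pi * t) =
      2 / t * (Real.sin (Real.pi * s) / Real.pi) := by
    rw [mul_comm s]
    field_simp
  rw [h6, ← hw, besselJ_eq, besselJ_eq, besselJ_eq, besselJ_eq]
  linear_combination besselG (s - 1) ((t / 2) ^ 2) * besselG (-s) ((t / 2) ^ 2) * h3 +
    besselG s ((t / 2) ^ 2) * besselG (1 - s) ((t / 2) ^ 2) * (h4 - h5)

/-- By the recurrence, both sides are determined by the cases `n = 0` and `n = 1`. -/
lemma besselJ_neg_natCast {t : ℝ} (ht : 0 < t) (n : ℕ) :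
    besselJ (-n) t = (-1) ^ n * besselJ n t := by
  induction n using Nat.twoStepInduction with
  | zero => simp
  | one =>
    have h := besselJ_sub_one ht 0
    simp only [zero_sub, mul_zero, zero_div, zero_mul, zero_add] at h
    simpa using h
  | more n h1 h2 =>
    have h3 := besselJ_sub_one ht (-(n + 1))
    have h4 := besselJ_sub_one ht (n + 1)
    push_cast at h1 h2 ⊢
    rw [show (-(n + 1) - 1 : ℝ) = -(n + 2) by ring, show (-(n + 1) + 1 : ℝ) = -n by ring] at h3
    rw [show (n + 1 - 1 : ℝ) = n by ring, show (n + 1 + 1 : ℝ) = n + 2 by ring] at h4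
    rw [h3, h2, h1, h4]
    ring

lemma besselJ_neg_intCast {t : ℝ} (ht : 0 < t) (n : ℤ) :
    besselJ (-n) t = Real.cos (n * Real.pi) * besselJ n t := by
  obtain ⟨m, rfl | rfl⟩ := n.eq_nat_or_neg
  · simpa [Real.cos_nat_mul_pi] using besselJ_neg_natCast ht m
  · have h : ((-1 : ℝ) ^ m) * (-1) ^ m = 1 := by rw [← mul_pow]; simp
    simp only [Int.cast_neg, Int.cast_natCast, neg_neg, neg_mul, Real.cos_neg,
      Real.cos_nat_mul_pi]
    rw [besselJ_neg_natCast ht m, ← mul_assoc, h, one_mul]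

/-! ### Dependence of `J_ν` on the order -/

/-- The power series converges locally uniformly at complex orders, so `J_s(t)` depends
analytically on `s`. -/
lemma differentiable_besselJ_order {t : ℝ} (ht : 0 < t) :
    Differentiable ℝ fun s => besselJ s t := by
  set z : ℝ := (t / 2) ^ 2
  have hG : Differentiable ℂ fun s : ℂ =>
      ∑' k : ℕ, ((-1) ^ k / k ! * z ^ k : ℂ) * (Complex.Gamma (s + k + 1))⁻¹ := by
    intro s
    obtain ⟨M, hM0, hM⟩ := exists_norm_inv_Gamma_le (‖s‖ + 1)
    have := Complex.differentiableOn_tsum_of_summable_norm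
      (F := fun (k : ℕ) (s : ℂ) => ((-1) ^ k / k ! * z ^ k : ℂ) * (Complex.Gamma (s + k + 1))⁻¹)
      (U := Metric.ball 0 (‖s‖ + 1)) ((Real.summable_pow_div_factorial |z|).mul_left M)
      ?_ Metric.isOpen_ball ?_
    · exact this.differentiableAt (Metric.isOpen_ball.mem_nhds (by simp))
    · intro k
      refine Differentiable.differentiableOn ?_
      exact (Complex.differentiable_one_div_Gamma.comp
        ((differentiable_id.add_const _).add_const _)).const_mul _
    · intro k w hw
      rw [norm_mul, norm_mul, norm_div, norm_pow, norm_neg, norm_one, one_pow, norm_pow,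
        Complex.norm_natCast, Complex.norm_real, Real.norm_eq_abs, mul_comm, one_div_mul_eq_div]
      exact mul_le_mul_of_nonneg_right (hM w (mem_ball_zero_iff.1 hw).le k) (by positivity)
  have hre : ∀ s : ℝ, besselG s z =
      (∑' k : ℕ, ((-1) ^ k / k ! * z ^ k : ℂ) * (Complex.Gamma ((s : ℂ) + k + 1))⁻¹).re := by
    intro s
    rw [besselG, ← Complex.ofReal_re (∑' k, besselTerm s z k), Complex.ofReal_tsum]
    congr 2
    ext k
    rw [show (s : ℂ) + k + 1 = ((s + k + 1 : ℝ) : ℂ) by push_cast; ring, Complex.Gamma_ofReal,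
      besselTerm, mul_comm (k ! : ℝ), div_mul_eq_div_div]
    push_cast
    ring
  intro s
  have h1 : DifferentiableAt ℝ (fun s => besselG s z) s := by
    simp only [hre]
    exact (hG s).hasDerivAt.real_of_complex.differentiableAt
  have h2 : DifferentiableAt ℝ (fun s : ℝ => (t / 2) ^ s) s :=
    (Real.hasStrictDerivAt_const_rpow (by positivity) s).hasDerivAt.differentiableAt
  simp only [besselJ_eq]
  exact h2.fun_mul h1

/-! ### Limits of solutions with varying order -/

/-- Bessel's equation as a first order system for `f = y_ν` and `g = y_{ν - 1}`. -/
lemma isBesselSolution_of_ladder {ν : ℝ} {f g : ℝ → ℝ}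
    (hf : ∀ t, 0 < t → HasDerivAt f (g t - ν / t * f t) t)
    (hg : ∀ t, 0 < t → HasDerivAt g ((ν - 1) / t * g t - f t) t) :
    IsBesselSolution ν f (fun t => g t - ν / t * f t) := by
  refine ⟨hf, fun t ht => ?_⟩
  refine ((hg t ht).fun_sub (((hasDerivAt_const t ν).fun_div (hasDerivAt_id' t) ht.ne').fun_mul
    (hf t ht))).congr_deriv ?_
  field_simp
  ring

/-- Grönwall's inequality bounds the solutions of orders near `ν` on a compact interval by their
initial values, uniformly in the order. -/
lemma exists_bound_of_tendsto {ν a b : ℝ} {l : Filter ℝ} (hl : Tendsto id l (𝓝 ν))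
    {x x₁ : ℝ → ℝ → ℝ} (hsol : ∀ᶠ s in l, IsBesselSolution s (x s) (x₁ s)) (ha : 0 < a)
    {p q : ℝ} (hp : Tendsto (fun s => x s a) l (𝓝 p)) (hq : Tendsto (fun s => x₁ s a) l (𝓝 q)) :
    ∃ M, ∀ᶠ s in l, ∀ t ∈ Icc a b,
      |-(x₁ s t) / t - (1 - s ^ 2 / t ^ 2) * x s t| ≤ M := by
  set S : ℝ := |ν| + 1 with hS
  set K : ℝ := 1 / a + (1 + S ^ 2 / a ^ 2) with hK
  have hK1 : 1 ≤ K := by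
    have : 0 ≤ 1 / a + S ^ 2 / a ^ 2 := by positivity
    linarith
  set δ : ℝ := ‖(p, q)‖ + 1 with hδ
  refine ⟨K * (δ * Real.exp (K * (b - a))), ?_⟩
  have h1 : ∀ᶠ s in l, |s| ≤ S := by
    refine (hl.abs.eventually (Iio_mem_nhds (lt_add_one |ν|))).mono fun s hs => le_of_lt hs
  have h2 : ∀ᶠ s in l, ‖(x s a, x₁ s a)‖ ≤ δ := by
    refine ((hp.prodMk_nhds hq).norm.eventually (Iio_mem_nhds (lt_add_one _))).mono
      fun s hs => le_of_lt hs
  filter_upwards [hsol, h1, h2] with s hs hsS hsδ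
  have hder : ∀ t, a ≤ t → |-(x₁ s t) / t - (1 - s ^ 2 / t ^ 2) * x s t| ≤
      K * ‖(x s t, x₁ s t)‖ := by
    intro t ht
    have ht0 := ha.trans_le ht
    have hx : |x s t| ≤ ‖(x s t, x₁ s t)‖ := norm_fst_le (x s t, x₁ s t)
    have hx₁ : |x₁ s t| ≤ ‖(x s t, x₁ s t)‖ := norm_snd_le (x s t, x₁ s t)
    refine (abs_sub _ _).trans ?_
    rw [hK, add_mul]
    refine add_le_add ?_ ?_
    · rw [abs_div, abs_neg, abs_of_pos ht0]
      calc |x₁ s t| / t ≤ ‖(x s t, x₁ s t)‖ / a := by gcongr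
        _ = _ := by ring
    · rw [abs_mul]
      refine mul_le_mul ?_ hx (abs_nonneg _) (by positivity)
      refine (abs_sub _ _).trans ?_
      rw [abs_one, abs_of_nonneg (by positivity : 0 ≤ s ^ 2 / t ^ 2), ← sq_abs s]
      gcongr
  have hgron : ∀ t ∈ Icc a b, ‖(x s t, x₁ s t)‖ ≤ δ * Real.exp (K * (t - a)) := by
    intro t ht
    rw [← gronwallBound_ε0]
    refine norm_le_gronwallBound_of_norm_deriv_right_le (f := fun t => (x s t, x₁ s t))
      (f' := fun t => (x₁ s t, -(x₁ s t) / t - (1 - s ^ 2 / t ^ 2) * x s t)) (b := b)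
      ?_ ?_ hsδ ?_ t ht
    · exact fun r hr => ((hs.hasDerivAt r (ha.trans_le hr.1)).prodMk
        (hs.hasDerivAt' r (ha.trans_le hr.1))).continuousAt.continuousWithinAt
    · exact fun r hr => ((hs.hasDerivAt r (ha.trans_le hr.1)).prodMk
        (hs.hasDerivAt' r (ha.trans_le hr.1))).hasDerivWithinAt
    · intro r hr
      rw [add_zero, Prod.norm_mk, max_le_iff]
      refine ⟨?_, hder r hr.1⟩
      have hx₁ : ‖x₁ s r‖ ≤ ‖(x s r, x₁ s r)‖ := norm_snd_le (x s r, x₁ s r)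
      exact hx₁.trans (le_mul_of_one_le_left (norm_nonneg _) hK1)
  intro t ht
  refine (hder t ht.1).trans (mul_le_mul_of_nonneg_left ((hgron t ht).trans ?_) (by linarith))
  gcongr
  exact ht.2

/-- The pointwise limit, as the order tends to `ν`, of solutions and their derivatives is again
differentiable with the expected derivative: second derivatives are locally bounded uniformly in
the order, so that the first order Taylor estimate passes to the limit. -/
lemma hasDerivAt_of_tendsto_isBesselSolution {ν : ℝ} {l : Filter ℝ} [l.NeBot]
    (hl : Tendsto id l (𝓝 ν)) {x x₁ : ℝ → ℝ → ℝ}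
    (hsol : ∀ᶠ s in l, IsBesselSolution s (x s) (x₁ s)) {X X₁ : ℝ → ℝ}
    (hX : ∀ t, 0 < t → Tendsto (fun s => x s t) l (𝓝 (X t)))
    (hX₁ : ∀ t, 0 < t → Tendsto (fun s => x₁ s t) l (𝓝 (X₁ t))) {t : ℝ} (ht : 0 < t) :
    HasDerivAt X (X₁ t) t := by
  have ht2 : 0 < t / 2 := by positivity
  obtain ⟨M, hM⟩ := exists_bound_of_tendsto (b := 2 * t) hl hsol ht2 (hX _ ht2) (hX₁ _ ht2)
  have htaylor : ∀ r ∈ Icc (t / 2) (2 * t), |X r - X t - (r - t) * X₁ t| ≤ M * |r - t| ^ 2 := by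
    intro r hr
    have hlim : Tendsto (fun s => |x s r - x s t - (r - t) * x₁ s t|) l
        (𝓝 |X r - X t - (r - t) * X₁ t|) :=
      (((hX r (ht2.trans_le hr.1)).sub (hX t ht)).sub ((hX₁ t ht).const_mul (r - t))).abs
    refine le_of_tendsto hlim ?_
    filter_upwards [hM, hsol] with s hsM hs
    have htI : t ∈ Icc (t / 2) (2 * t) := ⟨by linarith, by linarith⟩
    have hsub : uIcc t r ⊆ Icc (t / 2) (2 * t) := uIcc_subset_Icc htI hr
    have hM0 : 0 ≤ M := (abs_nonneg _).trans (hsM t htI)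
    have h1 : ∀ y ∈ uIcc t r, |x₁ s y - x₁ s t| ≤ M * |r - t| := by
      intro y hy
      refine (Convex.norm_image_sub_le_of_norm_hasDerivWithin_le
        (fun z hz => (hs.hasDerivAt' z (ht2.trans_le hz.1)).hasDerivWithinAt) hsM
        (convex_Icc _ _) htI (hsub hy)).trans ?_
      exact mul_le_mul_of_nonneg_left (abs_sub_left_of_mem_uIcc hy) hM0
    have h2 := Convex.norm_image_sub_le_of_norm_hasDerivWithin_le
      (f := fun y => x s y - y * x₁ s t) (f' := fun y => x₁ s y - 1 * x₁ s t)
      (fun z hz => ((hs.hasDerivAt z (ht2.trans_le (hsub hz).1)).fun_sub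
        ((hasDerivAt_id' z).mul_const (x₁ s t))).hasDerivWithinAt)
      (fun z hz => by rw [one_mul]; exact h1 z hz) (convex_uIcc t r) left_mem_uIcc right_mem_uIcc
    rw [Real.norm_eq_abs, Real.norm_eq_abs] at h2
    have h3 : x s r - x s t - (r - t) * x₁ s t =
        x s r - r * x₁ s t - (x s t - t * x₁ s t) := by ring
    rw [h3, sq, ← mul_assoc]
    exact h2
  rw [hasDerivAt_iff_isLittleO]
  refine Asymptotics.IsBigO.trans_isLittleO ?_
    (Asymptotics.isLittleO_pow_sub_sub t (by norm_num : 1 < 2))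
  refine Asymptotics.IsBigO.of_bound M ?_
  filter_upwards [Icc_mem_nhds (by linarith : t / 2 < t) (by linarith : t < 2 * t)] with r hr
  simpa using htaylor r hr

/-! ### The functions `Y_ν` -/

lemma besselYAux_add_one (s t : ℝ) : besselYAux (s + 1) t =
    (besselJ (s + 1) t * Real.cos (s * Real.pi) + besselJ (-s - 1) t) / Real.sin (s * Real.pi) := by
  rw [besselYAux, add_mul, one_mul, Real.cos_add_pi, Real.sin_add_pi, neg_add', div_neg, ← neg_div]
  ring

lemma besselYAux_sub_one_eq (s t : ℝ) : besselYAux (s - 1) t =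
    (besselJ (s - 1) t * Real.cos (s * Real.pi) + besselJ (1 - s) t) / Real.sin (s * Real.pi) := by
  rw [besselYAux, sub_mul, one_mul, Real.cos_sub_pi, Real.sin_sub_pi, neg_sub, div_neg, ← neg_div]
  ring

lemma besselYAux_sub_one {t : ℝ} (ht : 0 < t) (s : ℝ) :
    besselYAux (s - 1) t = 2 * s / t * besselYAux s t - besselYAux (s + 1) t := by
  have h1 := besselJ_sub_one ht s
  have h2 := besselJ_sub_one ht (-s)
  rw [neg_add_eq_sub] at h2
  rw [besselYAux_sub_one_eq, besselYAux_add_one, besselYAux, h1, h2]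
  ring

lemma hasDerivAt_besselYAux {t : ℝ} (ht : 0 < t) (s : ℝ) :
    HasDerivAt (besselYAux s) (s / t * besselYAux s t - besselYAux (s + 1) t) t := by
  have h := (((hasDerivAt_besselJ ht s).mul_const (Real.cos (s * Real.pi))).fun_sub
    (hasDerivAt_besselJ ht (-s))).div_const (Real.sin (s * Real.pi))
  refine h.congr_deriv ?_
  have h2 := besselJ_sub_one ht (-s)
  rw [besselYAux_add_one, besselYAux, h2]
  ring

/-- Bessel's equation for the members of a family of functions `y_ν` that satisfies the recurrence
relations of the Bessel functions. -/
lemma isBesselSolution_of_recurrence {y : ℝ → ℝ → ℝ}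
    (hd : ∀ ν t, 0 < t → HasDerivAt (y ν) (ν / t * y ν t - y (ν + 1) t) t)
    (hr : ∀ ν t, 0 < t → y (ν - 1) t = 2 * ν / t * y ν t - y (ν + 1) t) (ν : ℝ) :
    IsBesselSolution ν (y ν) (fun t => y (ν - 1) t - ν / t * y ν t) := by
  refine isBesselSolution_of_ladder (fun t ht => (hd ν t ht).congr_deriv ?_) fun t ht => ?_
  · rw [hr ν t ht]
    ring
  · simpa using hd (ν - 1) t ht

lemma isBesselSolution_besselJ (ν : ℝ) :
    IsBesselSolution ν (besselJ ν) (fun t => besselJ (ν - 1) t - ν / t * besselJ ν t) :=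
  isBesselSolution_of_recurrence (fun ν _ ht => hasDerivAt_besselJ ht ν)
    (fun ν _ ht => besselJ_sub_one ht ν) ν

lemma hasDerivAt_sin_mul_pi (ν : ℝ) :
    HasDerivAt (fun s : ℝ => Real.sin (s * Real.pi)) (Real.cos (ν * Real.pi) * Real.pi) ν := by
  simpa using ((hasDerivAt_id' ν).mul_const Real.pi).sin

lemma eventually_sin_mul_pi_ne_zero (ν : ℝ) : ∀ᶠ s in 𝓝[≠] ν, Real.sin (s * Real.pi) ≠ 0 := by
  by_cases h : Real.sin (ν * Real.pi) = 0
  · refine (hasDerivAt_sin_mul_pi ν).eventually_ne ?_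
    refine mul_ne_zero (fun hc => ?_) Real.pi_ne_zero
    have := Real.sin_sq_add_cos_sq (ν * Real.pi)
    simp [h, hc] at this
  · exact nhdsWithin_le_nhds ((hasDerivAt_sin_mul_pi ν).continuousAt.eventually_ne h)

/-- For every order `ν`, integer or not, `Y_ν(t)` is the limit of the expression that defines `Y_s`
at the non-integer orders `s`; at an integer, numerator and denominator both vanish, and the
denominator has a nonzero derivative in `s`. -/
lemma tendsto_besselYAux {t : ℝ} (ht : 0 < t) (ν : ℝ) :
    Tendsto (fun s => besselYAux s t) (𝓝[≠] ν) (𝓝 (besselY ν t)) := by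
  set num : ℝ → ℝ := fun s => besselJ s t * Real.cos (s * Real.pi) - besselJ (-s) t with hnum
  have hdiff : Differentiable ℝ num := by
    have h1 := differentiable_besselJ_order ht
    exact (h1.fun_mul (Real.differentiable_cos.comp (differentiable_id.mul_const _))).fun_sub
      (h1.comp differentiable_neg)
  by_cases h : ∃ n : ℤ, ν = n
  · rw [besselY, if_pos h]
    refine tendsto_nhds_limUnder ?_
    obtain ⟨n, rfl⟩ := h
    have hsin : Real.sin (n * Real.pi) = 0 := Real.sin_int_mul_pi n
    have hcos : Real.cos (n * Real.pi) ≠ 0 := by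
      intro hc
      have := Real.sin_sq_add_cos_sq (n * Real.pi)
      simp [hsin, hc] at this
    have hnum0 : num n = 0 := by
      simp only [hnum, besselJ_neg_intCast ht n]
      ring
    have h1 := hasDerivAt_iff_tendsto_slope.1 (hdiff n).hasDerivAt
    have h2 := hasDerivAt_iff_tendsto_slope.1 (hasDerivAt_sin_mul_pi n)
    refine ⟨_, (h1.div h2 (mul_ne_zero hcos Real.pi_ne_zero)).congr' ?_⟩
    filter_upwards [self_mem_nhdsWithin] with s hs
    have hs' : s - n ≠ 0 := sub_ne_zero.2 hs
    rw [Pi.div_apply, slope_def_field, slope_def_field, hnum0, hsin, sub_zero, sub_zero,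
      div_div_div_cancel_right₀ hs']
    rfl
  · rw [besselY, if_neg h]
    have hsin : Real.sin (ν * Real.pi) ≠ 0 := by
      intro h0
      obtain ⟨n, hn⟩ := Real.sin_eq_zero_iff.1 h0
      exact h ⟨n, (mul_right_cancel₀ Real.pi_ne_zero hn).symm⟩
    exact (((hdiff ν).continuousAt.div (hasDerivAt_sin_mul_pi ν).continuousAt
      hsin).tendsto).mono_left nhdsWithin_le_nhds

lemma tendsto_besselYAux_add {t : ℝ} (ht : 0 < t) (ν c : ℝ) :
    Tendsto (fun s => besselYAux (s + c) t) (𝓝[≠] ν) (𝓝 (besselY (ν + c) t)) := by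
  refine (tendsto_besselYAux ht (ν + c)).comp (tendsto_nhdsWithin_iff.2 ⟨?_, ?_⟩)
  · exact ((continuous_id.add continuous_const).tendsto ν).mono_left nhdsWithin_le_nhds
  · filter_upwards [self_mem_nhdsWithin] with s hs
    simpa using hs

lemma tendsto_id_nhdsNE (ν : ℝ) : Tendsto id (𝓝[≠] ν) (𝓝 ν) := tendsto_id'.2 nhdsWithin_le_nhds

lemma besselY_sub_one {t : ℝ} (ht : 0 < t) (ν : ℝ) :
    besselY (ν - 1) t = 2 * ν / t * besselY ν t - besselY (ν + 1) t := by
  refine tendsto_nhds_unique (tendsto_besselYAux_add ht ν (-1)) ?_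
  simp only [← sub_eq_add_neg, besselYAux_sub_one ht]
  exact ((((tendsto_id_nhdsNE ν).const_mul 2).div_const t).mul (tendsto_besselYAux ht ν)).sub
    (tendsto_besselYAux_add ht ν 1)

lemma hasDerivAt_besselY {t : ℝ} (ht : 0 < t) (ν : ℝ) :
    HasDerivAt (besselY ν) (ν / t * besselY ν t - besselY (ν + 1) t) t := by
  have hsol := isBesselSolution_of_recurrence (y := besselYAux)
    (fun ν _ ht => hasDerivAt_besselYAux ht ν) (fun ν _ ht => besselYAux_sub_one ht ν)
  refine (hasDerivAt_of_tendsto_isBesselSolution (tendsto_id_nhdsNE ν)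
    (Eventually.of_forall hsol) (fun t ht => tendsto_besselYAux ht ν)
    (X₁ := fun t => besselY (ν - 1) t - ν / t * besselY ν t) (fun t ht => ?_) ht).congr_deriv ?_
  · have h1 := tendsto_besselYAux_add ht ν (-1)
    simp only [← sub_eq_add_neg] at h1
    exact h1.sub (((tendsto_id_nhdsNE ν).div_const t).mul (tendsto_besselYAux ht ν))
  · rw [besselY_sub_one ht]
    ring

lemma isBesselSolution_besselY (ν : ℝ) :
    IsBesselSolution ν (besselY ν) (fun t => besselY (ν - 1) t - ν / t * besselY ν t) :=
  isBesselSolution_of_recurrence (fun ν _ ht => hasDerivAt_besselY ht ν)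
    (fun ν _ ht => besselY_sub_one ht ν) ν

/-- The Wronskian of `J_ν` and `Y_ν`. -/
lemma besselJ_besselY_wronskian {t : ℝ} (ht : 0 < t) (ν : ℝ) :
    besselJ ν t * besselY (ν - 1) t - besselJ (ν - 1) t * besselY ν t = 2 / (Real.pi * t) := by
  have hJ : ∀ c, Tendsto (fun s => besselJ (s + c) t) (𝓝[≠] ν) (𝓝 (besselJ (ν + c) t)) := fun c =>
    (((differentiable_besselJ_order ht).continuous.comp
      (continuous_add_const c)).tendsto ν).mono_left nhdsWithin_le_nhds
  have hlim := ((hJ 0).mul (tendsto_besselYAux_add ht ν (-1))).sub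
    ((hJ (-1)).mul (tendsto_besselYAux ht ν))
  simp only [add_zero, ← sub_eq_add_neg] at hlim
  refine tendsto_nhds_unique hlim (tendsto_const_nhds.congr' ?_)
  filter_upwards [eventually_sin_mul_pi_ne_zero ν] with s hs
  have hw := besselJ_wronskian ht s
  rw [besselYAux_sub_one_eq, besselYAux]
  have hw' : (besselJ (s - 1) t * besselJ (-s) t + besselJ s t * besselJ (1 - s) t) /
      Real.sin (s * Real.pi) = 2 / (Real.pi * t) := by
    rw [hw]
    field_simp
  rw [← hw']
  ring

/-! ### The phase dimension of `J_ν` and `Y_ν` -/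

theorem corollary1 (ν τ₀ : ℝ) (hτ₀ : 0 < τ₀) :
    HasPhaseDim (besselJ ν) τ₀ (4 / 3) ∧ HasPhaseDim (besselY ν) τ₀ (4 / 3) := by
  have hw := besselJ_besselY_wronskian one_pos ν
  have hpos : (2 : ℝ) / (Real.pi * 1) ≠ 0 := by positivity
  refine ⟨(isBesselSolution_besselJ ν).hasPhaseDim one_pos ?_ hτ₀,
    (isBesselSolution_besselY ν).hasPhaseDim one_pos ?_ hτ₀⟩
  all_goals
    rintro ⟨h1, h2⟩
    simp only [h1, mul_zero, sub_zero] at h2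
    simp only [h1, h2, zero_mul, mul_zero, sub_zero] at hw
    exact hpos hw.symm
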